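/- Let $\mathcal M$ be a first-order structure with universe $M$ in a countable language. Suppose that $\mathcal M$ is $\omega$-categorical (any two countably infinite models of its complete theory are isomorphic) and that its algebraic closure is degenerate, i.e. $\mathrm{acl}_{\mathcal M}(A)=A$ for every $A\subseteq M$. Let $0<n<\omega$, let $p$ be a complete $n$-type over $\emptyset$ with respect to the complete theory of $\mathcal M$, and let $X\subseteq M^n$ be the set of realizations of $p$ in $\mathcal M$. Assume that the following condition holds. $(*)$ Let the set of coordinates $\{1,\dots,n\}$ be split into two parts (the first possibly empty, the second nonempty), and for a tuple $\bar a'$ indexed by the first part and a tuple $\bar a$ indexed by the second part write $\bar a'\bar a$ for the resulting $n$-tuple. If $\bar a',\bar a^*,\bar b^*,\bar c^*,\bar d^*$ are tuples of elements of $M$ with pairwise disjoint ranges, $\bar a'$ being indexed by the first part and the starred tuples by the second part, and $\bar a'\bar a^*,\ \bar a'\bar b^*,\ \bar a'\bar c^*,\ \bar a'\bar d^*\in X$, then there is a tuple $\bar e^*$ of elements of $M$ such that $$\mathrm{tp}_{\mathcal M}(\bar e^*,\bar a^*,\bar a')=\mathrm{tp}_{\mathcal M}(\bar c^*,\bar a^*,\bar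 a')\quad\text{and}\quad \mathrm{tp}_{\mathcal M}(\bar e^*,\bar b^*,\bar a')=\mathrm{tp}_{\mathcal M}(\bar d^*,\bar b^*,\bar a').$$ Let $E$ be an equivalence relation on $X$ that is $\emptyset$-definable in $\mathcal M$ (there is a formula $\varphi(\bar x,\bar y)$ without parameters such that, for all $\bar a,\bar b\in X$, $E(\bar a,\bar b)$ if and only if $\mathcal M\models\varphi(\bar a,\bar b)$) and nontrivial (it has at least two classes, and at least one class has more than one element). Then there are a nonempty set $I\subseteq\{1,\dots,n\}$ and a group $\Gamma$ of permutations of $I$ such that for all $\bar a=(a_1,\dots,a_n)$ and $\bar b=(b_1,\dots,b_n)$ in $X$, $$E(\bar a,\bar b)\iff \text{there is } \gamma\in\Gamma \text{ such that } a_i=b_{\gamma(i)} \text{ for all } i\in I.$$ -/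

import Mathlib

namespace DegenerateAcl


universe u v w

/-- The model-theoretic algebraic closure `acl_M(A)`: all elements of `M` that belong to some
finite subset of `M` which is definable with parameters from `A`. -/
def acl (L : FirstOrder.Language.{u, v}) {M : Type w} [L.Structure M] (A : Set M) : Set M :=
  {x | ∃ s : Set M, A.Definable₁ L s ∧ s.Finite ∧ x ∈ s}

/-- `M` has degenerate algebraic closure: `acl_M(A) = A` for every `A ⊆ M`. -/
def HasDegenerateAcl (L : FirstOrder.Language.{u, v}) (M : Type w) [L.Structure M] : Prop :=
  ∀ A : Set M, acl L A = A

/-- `M` is ω-categorical: any two countably infinite models of the complete theory of `M` are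
isomorphic (to be used for structures in a countable language). -/
def IsOmegaCategorical (L : FirstOrder.Language.{u, v}) (M : Type w) [L.Structure M] : Prop :=
  (Cardinal.aleph0.{w}).Categorical (L.completeTheory M)

/-- The complete type `tp_M(a)` over `∅` of a tuple `a` of elements of `M`. -/
def tp (L : FirstOrder.Language.{u, v}) {M : Type w} [L.Structure M] [Nonempty M] {α : Type} (a : α → M) :
    (L.completeTheory M).CompleteType α :=
  (L.completeTheory M).typeOf a

/-- The set of realizations in `M` of a complete `n`-type over `∅`. -/
def realizations {L : FirstOrder.Language.{u, v}} {M : Type w} [L.Structure M] [Nonempty M] {n : ℕ}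
    (p : (L.completeTheory M).CompleteType (Fin n)) : Set (Fin n → M) :=
  {a | tp L a = p}

/-- The `n`-tuple `a'a` formed from a `k`-tuple `a'` and an `m`-tuple `a`, where the bijection `σ`
says which coordinate of the `n`-tuple each of the `k + m` entries occupies. -/
def combine {M : Type w} {k m n : ℕ} (σ : Fin k ⊕ Fin m ≃ Fin n) (a' : Fin k → M)
    (a : Fin m → M) : Fin n → M :=
  fun i => Sum.elim a' a (σ.symm i)

/-- The amalgamation condition `(∗)` for a set `X` of `n`-tuples. Whenever the `n` coordinates are
split into `k ≥ 0` coordinates (for `a'`) and `m ≥ 1` coordinates (for the starred tuples), and the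
tuples `a', a, b, c, d` have pairwise disjoint ranges and `a'a, a'b, a'c, a'd ∈ X`, there is `e` with
`tp(e, a, a') = tp(c, a, a')` and `tp(e, b, a') = tp(d, b, a')`. -/
def AmalgamationCondition (L : FirstOrder.Language.{u, v}) {M : Type w} [L.Structure M] [Nonempty M] {n : ℕ}
    (X : Set (Fin n → M)) : Prop :=
  ∀ (k m : ℕ) (σ : Fin k ⊕ Fin m ≃ Fin n), 0 < m →
    ∀ (a' : Fin k → M) (a b c d : Fin m → M),
      [a, b, c, d].Pairwise (fun x y => Disjoint (Set.range x) (Set.range y)) →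
      (∀ x ∈ [a, b, c, d], Disjoint (Set.range a') (Set.range x)) →
      (∀ x ∈ [a, b, c, d], combine σ a' x ∈ X) →
      ∃ e : Fin m → M,
        tp L (Sum.elim e (Sum.elim a a')) = tp L (Sum.elim c (Sum.elim a a')) ∧
        tp L (Sum.elim e (Sum.elim b a')) = tp L (Sum.elim d (Sum.elim b a'))

/-- The equivalence relation `E` on `X ⊆ Mⁿ` is `∅`-definable: some formula `φ(x, y)` without
parameters satisfies `E(a, b) ↔ M ⊨ φ(a, b)` for all `a, b ∈ X`. -/
def IsDefinableOn (L : FirstOrder.Language.{u, v}) {M : Type w} [L.Structure M] {n : ℕ}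
    {X : Set (Fin n → M)} (E : Setoid X) : Prop :=
  ∃ φ : L.Formula (Fin n ⊕ Fin n), ∀ a b : X, E a b ↔ φ.Realize (Sum.elim a.1 b.1)

/-- An equivalence relation is nontrivial if it has at least two classes and at least one class
with more than one element. -/
def IsNontrivialEquiv {X : Type w} (E : Setoid X) : Prop :=
  (∃ a b : X, ¬ E a b) ∧ ∃ a b : X, a ≠ b ∧ E a b

end DegenerateAcl

namespace DegenerateAcl

open FirstOrder FirstOrder.Language Set

/-! ### Omitting types, and isolation of types under ω-categoricity. -/

section ModelTheory

universe u v w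

variable {L : FirstOrder.Language.{u, v}} {M : Type w} [L.Structure M]

/-! By ω-categoricity every type of a finite tuple is isolated (one direction of Ryll-Nardzewski,
obtained by omitting types). Hence a tuple extending `a` can be copied over any `b` of the same
type, and degenerate algebraic closure lets such copies avoid any finite set outside the base.

Call a set of coordinates determining if agreement on it forces `E`. The heart is
`determines_of_agree`: let `a`, `c` be equivalent, agreeing on `J` and disjoint elsewhere. If `J`
were not determining, there would be a fresh copy `b` of `c` over `a`, and a fresh `d` agreeing on
`J` but inequivalent to `b`. Condition (∗) gives `e` related to `a` as `c` is and to `b` as `d` is;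
then `e`, `a`, `b` are equivalent, so `d` and `b` are too, a contradiction.

Now let `I` be a minimal determining set. Equivalent tuples have the same entries on `I`
(`mem_image_of_minimal_determines`), without repetition, so they differ there by a permutation.
Since `E` depends only on types, a permutation realized by one equivalent pair yields equivalence
for every pair it matches, and these permutations form the group. -/

theorem exists_finset_support {β : Type*} (φ : L.Formula β) :
    ∃ s : Finset β, ∀ v v' : β → M, (∀ i ∈ s, v i = v' i) → (φ.Realize v ↔ φ.Realize v') := by
  classical
  refine ⟨φ.freeVarFinset, fun v v' h => ?_⟩
  have h1 := BoundedFormula.realize_restrictFreeVar (M := M) (φ := φ) (f := id)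
    (v := fun a => v a) (xs := default) v (fun _ => rfl)
  have h2 := BoundedFormula.realize_restrictFreeVar (M := M) (φ := φ) (f := id)
    (v := fun a => v a) (xs := default) v' (fun a => (h a a.2))
  exact h1.symm.trans h2

theorem exists_formula_fin {α : Type*} [Finite α] (i : α → ℕ) (φ : L.Formula ℕ) :
    ∃ (k : ℕ) (φ' : L.Formula (Fin k)) (i' : α → Fin k), (∀ x, (i' x : ℕ) = i x) ∧
      ∀ v : ℕ → M, φ.Realize v ↔ φ'.Realize (fun j => v j) := by
  obtain ⟨s, hs⟩ := exists_finset_support (M := M) φ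
  have hfin : (↑s ∪ range i : Set ℕ).Finite := s.finite_toSet.union (finite_range i)
  obtain ⟨k, hk⟩ := hfin.bddAbove
  refine ⟨k + 1, φ.relabel (fun m => if h : m < k + 1 then ⟨m, h⟩ else 0),
    fun x => ⟨i x, Nat.lt_succ_of_le (hk (Or.inr ⟨x, rfl⟩))⟩, fun _ => rfl, fun v => ?_⟩
  rw [Formula.realize_relabel]
  refine hs _ _ fun m hm => ?_
  have : m < k + 1 := Nat.lt_succ_of_le (hk (Or.inl hm))
  simp only [Function.comp_apply, dif_pos this]

/-- Compactness for sets of formulas in countably many variables. -/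
theorem exists_realization (T : Set (L.Formula ℕ))
    (h : ∀ s : Finset (L.Formula ℕ), ↑s ⊆ T → ∃ v : ℕ → M, ∀ φ ∈ s, φ.Realize v) :
    ∃ (N : Type (max u v)) (_ : L.Structure N) (_ : Nonempty N) (c : ℕ → N),
      ∀ φ ∈ T, φ.Realize c := by
  classical
  obtain ⟨v₀, -⟩ := h ∅ (by simp)
  have : Nonempty M := ⟨v₀ 0⟩
  have hsat : Theory.IsSatisfiable (Formula.equivSentence '' T : L[[ℕ]].Theory) := by
    rw [Theory.isSatisfiable_iff_isFinitelySatisfiable]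
    intro T0 hT0
    obtain ⟨v, hv⟩ := h (T0.image Formula.equivSentence.symm) (by
      intro φ hφ
      simp only [Finset.coe_image, mem_image, Finset.mem_coe] at hφ
      obtain ⟨σ, hσ, rfl⟩ := hφ
      obtain ⟨ψ, hψ, rfl⟩ := hT0 hσ
      simpa using hψ)
    let := constantsOn.structure v
    have : M ⊨ (T0 : L[[ℕ]].Theory) := by
      refine Theory.model_iff _ |>.2 fun σ hσ => ?_
      rw [← Formula.realize_equivSentence_symm]
      exact hv _ (Finset.mem_image_of_mem _ hσ)
    exact Theory.Model.isSatisfiable M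
  obtain ⟨N⟩ := hsat
  let N' := (L.lhomWithConstants ℕ).reduct N
  let : L.Structure N := N'
  have : (L.lhomWithConstants ℕ).IsExpansionOn N := LHom.isExpansionOn_reduct _ _
  refine ⟨N, N', inferInstance, fun i => (L.con i : N), fun φ hφ => ?_⟩
  rw [← Formula.realize_equivSentence]
  exact N.is_model.realize_of_mem _ ⟨φ, hφ, rfl⟩

/-- The type of `a` is isolated by a formula. -/
def IsIsolated (L : FirstOrder.Language.{u, v}) {M : Type w} [L.Structure M] {α : Type*}
    (a : α → M) : Prop :=
  ∃ φ : L.Formula α, φ.Realize a ∧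
    ∀ b : α → M, φ.Realize b → ∀ ψ : L.Formula α, ψ.Realize a → ψ.Realize b

variable (L M) in
/-- Formulas in countably many variables that are satisfiable in `M`, stronger formulas being
larger. -/
def SatFormula : Type (max u v) := {φ : L.Formula ℕ // ∃ v : ℕ → M, φ.Realize v}

instance : Preorder (SatFormula L M) where
  le φ ψ := ∀ v : ℕ → M, ψ.1.Realize v → φ.1.Realize v
  le_refl _ _ h := h
  le_trans _ _ _ h h' v hv := h v (h' v hv)

/-- The formula saying that the `j`-th variable witnesses `∃ y, φ(x, y)`. -/
noncomputable def henkin (φ : L.Formula (ℕ ⊕ Fin 1)) (j : ℕ) : L.Formula ℕ :=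
  (φ.iExs (Fin 1)).imp (φ.relabel (Sum.elim id fun _ => j))

theorem realize_henkin {N : Type*} [L.Structure N] (φ : L.Formula (ℕ ⊕ Fin 1)) (j : ℕ)
    (v : ℕ → N) : (henkin φ j).Realize v ↔
      ((∃ y : Fin 1 → N, φ.Realize (Sum.elim v y)) → φ.Realize (Sum.elim v fun _ => v j)) := by
  rw [henkin, Formula.realize_imp, Formula.realize_iExs, Formula.realize_relabel]
  have : v ∘ (Sum.elim id fun _ => j) = Sum.elim v (fun _ : Fin 1 => v j) := by
    ext x; cases x <;> rfl
  rw [this]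

/-- A variable occurring in neither formula is free to be reassigned to a witness; if no witness
exists the implication is vacuous. -/
theorem henkin_cofinal [Nonempty M] (φ : L.Formula (ℕ ⊕ Fin 1)) :
    IsCofinal {θ : SatFormula L M | ∃ j, ∀ v : ℕ → M, θ.1.Realize v → (henkin φ j).Realize v} := by
  classical
  rintro ⟨θ, v, hv⟩
  obtain ⟨s, hs⟩ := exists_finset_support (M := M) θ
  obtain ⟨t, ht⟩ := exists_finset_support (M := M) φ
  obtain ⟨j, hj⟩ := Infinite.exists_notMem_finset (s ∪ t.toLeft)
  simp only [Finset.mem_union, not_or, Finset.mem_toLeft] at hj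
  have key : ∃ v' : ℕ → M, (θ ⊓ henkin φ j).Realize v' := by
    simp only [Formula.realize_inf, realize_henkin]
    by_cases hy : ∃ y : Fin 1 → M, φ.Realize (Sum.elim v y)
    · obtain ⟨y, hy⟩ := hy
      refine ⟨Function.update v j (y 0), (hs _ _ fun i hi => ?_).1 hv, fun _ => (ht _ _ ?_).1 hy⟩
      · rw [Function.update_of_ne]; rintro rfl; exact hj.1 hi
      · rintro (i | i) hi
        · simp only [Sum.elim_inl]; rw [Function.update_of_ne]; rintro rfl; exact hj.2 hi
        · simp [Subsingleton.elim i 0]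
    · exact ⟨v, hv, fun h => (hy h).elim⟩
  exact ⟨⟨θ ⊓ henkin φ j, key⟩, ⟨j, fun v' h' => (Formula.realize_inf.1 h').2⟩,
    fun v' h' => (Formula.realize_inf.1 h').1⟩

/-- If no strengthening of `θ` omitted the type of `a` at the variables `i`, then `θ` would imply
that whole type, and its projection to these variables would isolate it. -/
theorem omit_cofinal {α : Type} [Finite α] {a : α → M} (ha : ¬ IsIsolated L a) (i : α → ℕ) :
    IsCofinal {θ : SatFormula L M | ∃ ψ : L.Formula α, ψ.Realize a ∧
      ∀ v : ℕ → M, θ.1.Realize v → ¬ ψ.Realize (v ∘ i)} := by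
  rintro ⟨θ, v, hv⟩
  by_contra hcon
  have h1 : ∀ ψ : L.Formula α, ψ.Realize a → ∀ v : ℕ → M, θ.Realize v → ψ.Realize (v ∘ i) := by
    intro ψ hψ v' hv'
    by_contra hn
    refine hcon ⟨⟨θ ⊓ (ψ.relabel i).not, v', ?_⟩, ⟨ψ, hψ, fun v'' h'' => ?_⟩, fun v'' h'' => ?_⟩
    · simpa [Formula.realize_relabel] using And.intro hv' hn
    · simpa [Formula.realize_relabel] using (Formula.realize_inf.1 h'').2
    · exact (Formula.realize_inf.1 h'').1
  -- Only finitely many variables matter, so the projection of `θ` along `i` is definable, by `χ`.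
  obtain ⟨k, θ', i', hi, hθ'⟩ := exists_formula_fin (M := M) i θ
  have hdef : (∅ : Set M).Definable L (Set.ofPred θ'.Realize) := empty_definable_iff.2 ⟨θ', rfl⟩
  obtain ⟨χ, hχ⟩ := empty_definable_iff.1 (hdef.image_comp i')
  have hχ' : ∀ b : α → M, χ.Realize b ↔ ∃ w : ℕ → M, θ.Realize w ∧ w ∘ i = b := by
    intro b
    have : b ∈ (fun g : Fin k → M => g ∘ i') '' Set.ofPred θ'.Realize ↔ χ.Realize b := by
      rw [hχ]; rfl
    rw [← this]
    constructor
    · rintro ⟨g, hg, rfl⟩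
      have e : (fun j : Fin k => (fun m => if h : m < k then g ⟨m, h⟩ else v 0 : ℕ → M) j) = g := by
        ext j; simp
      refine ⟨fun m => if h : m < k then g ⟨m, h⟩ else v 0, (hθ' _).2 ?_, ?_⟩
      · rw [e]; exact hg
      · ext x; simp [← hi]
    · rintro ⟨w, hw, rfl⟩
      exact ⟨fun j => w j, (hθ' _).1 hw, by ext x; simp [hi]⟩
  have hχa : χ.Realize a := by
    by_contra hn
    have := h1 χ.not (by simpa using hn) v hv
    rw [Formula.realize_not, hχ'] at this
    exact this ⟨v, hv, rfl⟩
  refine ha ⟨χ, hχa, fun b hb ψ hψ => ?_⟩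
  obtain ⟨w, hw, rfl⟩ := (hχ' b).1 hb
  exact h1 ψ hψ w hw

/-- The omitting types theorem for a single type realized in `M`. -/
theorem exists_countable_model_omitting [Countable L.Symbols] [Nonempty M] {α : Type} [Finite α]
    {a : α → M} (ha : ¬ IsIsolated L a) :
    ∃ (N : Type (max u v)) (_ : L.Structure N), Countable N ∧ L.ElementarilyEquivalent M N ∧
      ∀ b : α → N, ∃ ψ : L.Formula α, ψ.Realize a ∧ ¬ ψ.Realize b := by
  classical
  have : Countable (L.Formula (ℕ ⊕ Fin 1)) := inferInstance
  let : Encodable (L.Formula (ℕ ⊕ Fin 1) ⊕ (α → ℕ)) := Encodable.ofCountable _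
  -- A sequence of conditions meeting all these countably many cofinal sets gives a Henkin model in
  -- which every tuple of named elements omits the type.
  let 𝒟 : L.Formula (ℕ ⊕ Fin 1) ⊕ (α → ℕ) → Order.Cofinal (SatFormula L M) :=
    Sum.elim (fun φ => ⟨_, henkin_cofinal φ⟩) (fun i => ⟨_, omit_cofinal ha i⟩)
  let θ₀ : SatFormula L M := ⟨⊤, fun _ => Classical.arbitrary M, by simp⟩
  let θ := Order.sequenceOfCofinals θ₀ 𝒟
  have hmono : Monotone θ := Order.sequenceOfCofinals.monotone θ₀ 𝒟
  let T : Set (L.Formula ℕ) := {φ | ∃ n, ∀ v : ℕ → M, (θ n).1.Realize v → φ.Realize v}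
  obtain ⟨N, _, _, c, hc⟩ := exists_realization (M := M) T (by
    intro s hs
    have : ∃ n, ∀ φ ∈ s, ∀ v : ℕ → M, (θ n).1.Realize v → φ.Realize v := by
      induction s using Finset.induction_on with
      | empty => exact ⟨0, by simp⟩
      | insert φ s _ ih =>
        rw [Finset.coe_insert, insert_subset_iff] at hs
        obtain ⟨n, hn⟩ := ih hs.2
        obtain ⟨m, hm⟩ := hs.1
        refine ⟨max n m, fun ψ hψ v hv => ?_⟩
        rcases Finset.mem_insert.1 hψ with rfl | hψ
        · exact hm v (hmono (le_max_right n m) v hv)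
        · exact hn ψ hψ v (hmono (le_max_left n m) v hv)
    obtain ⟨n, hn⟩ := this
    obtain ⟨v, hv⟩ := (θ n).2
    exact ⟨v, fun φ hφ => hn φ hφ v hv⟩)
  have hMN : L.ElementarilyEquivalent M N := by
    have : ∀ σ : L.Sentence, M ⊨ σ → N ⊨ σ := by
      intro σ hσ
      have := hc (Formula.relabel (Empty.elim : Empty → ℕ) σ)
        ⟨0, fun v _ => by
          rw [Formula.realize_relabel, Subsingleton.elim (v ∘ Empty.elim) default]; exact hσ⟩
      rwa [Formula.realize_relabel, Subsingleton.elim (c ∘ Empty.elim) default] at this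
    rw [elementarilyEquivalent_iff]
    refine fun σ => ⟨this σ, fun h => ?_⟩
    by_contra hn
    exact (Formula.realize_not.1 (this σ.not (Formula.realize_not.2 hn))) h
  -- The Henkin witnesses provide the Tarski–Vaught criterion for the named elements.
  have hmeet : L.MeetsDefinable (range c) := by
    intro D hD hdef
    obtain ⟨φ, hφ⟩ := definable_iff_exists_formula_sum.1 hdef
    let f : range c → ℕ := fun x => x.2.choose
    have hf : ∀ x, c (f x) = x := fun x => x.2.choose_spec
    let φ' : L.Formula (ℕ ⊕ Fin 1) := φ.relabel (Sum.map f id)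
    have hφ' : ∀ y : N, φ'.Realize (Sum.elim c fun _ => y) ↔ y ∈ D := by
      intro y
      have h1 : (fun _ : Fin 1 => y) ∈ {x : Fin 1 → N | x 0 ∈ D} ↔ y ∈ D := Iff.rfl
      rw [← h1, hφ, Formula.realize_relabel]
      have : (Sum.elim c fun _ : Fin 1 => y) ∘ Sum.map f id
          = Sum.elim (fun x : range c => (x : N)) fun _ => y := by
        ext x; cases x <;> simp [hf]
      rw [this]; rfl
    obtain ⟨j, hj⟩ := Order.sequenceOfCofinals.encode_mem θ₀ 𝒟 (Sum.inl φ')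
    have := (realize_henkin _ _ _).1 (hc (henkin φ' j) ⟨_, hj⟩)
    obtain ⟨y, hy⟩ := hD
    exact ⟨c j, (hφ' _).1 (this ⟨fun _ => y, (hφ' y).2 hy⟩), j, rfl⟩
  let S := hmeet.toElementarySubstructure
  have hS : (S : Set N) = range c := hmeet.closure_eq_self
  refine ⟨S, inferInstance, ?_, ?_, fun b => ?_⟩
  · exact (hS ▸ countable_range c : (S : Set N).Countable).to_subtype
  · exact hMN.trans S.elementarilyEquivalent.symm
  · have : ∀ x, ∃ k, c k = b x := fun x => by
      have : (b x : N) ∈ (S : Set N) := (b x).2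
      rwa [hS] at this
    choose i hi using this
    obtain ⟨ψ, hψ, hψ'⟩ := Order.sequenceOfCofinals.encode_mem θ₀ 𝒟 (Sum.inr i)
    refine ⟨ψ, hψ, fun hb => ?_⟩
    have h2 := hc (ψ.relabel i).not ⟨_, fun v hv => by
      rw [Formula.realize_not, Formula.realize_relabel]; exact hψ' v hv⟩
    rw [Formula.realize_not, Formula.realize_relabel] at h2
    apply h2
    have h3 := (S.subtype.map_formula ψ b).2 hb
    convert h3 using 1
    ext x; simp [hi]

theorem infinite_of_hasDegenerateAcl [Nonempty M] (hacl : HasDegenerateAcl L M) : Infinite M := by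
  by_contra h
  rw [not_infinite_iff_finite] at h
  obtain ⟨x⟩ := ‹Nonempty M›
  have : x ∈ acl L (∅ : Set M) := ⟨univ, definable_univ, toFinite _, mem_univ x⟩
  rw [hacl] at this
  exact this

/-- In an `ω`-categorical structure the types of finite tuples are isolated. -/
theorem IsOmegaCategorical.isIsolated [Countable L.Symbols] [Nonempty M] [Infinite M]
    (hcat : IsOmegaCategorical L M) {α : Type} [Finite α] (a : α → M) : IsIsolated L a := by
  by_contra ha
  obtain ⟨N, _, hNc, hMN, hN⟩ := exists_countable_model_omitting ha
  have : Infinite N := hMN.infinite_iff.1 inferInstance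
  obtain ⟨e⟩ : Nonempty (N ≃ ULift.{w} ℕ) := by
    obtain ⟨e⟩ := nonempty_equiv_of_countable (α := N) (β := ℕ)
    exact ⟨e.trans Equiv.ulift.symm⟩
  -- The omitting model is copied onto a countable set in the universe of `M`, where categoricity
  -- applies.
  let : L.Structure (ULift.{w} ℕ) := e.inducedStructure
  let e' : N ≃[L] ULift.{w} ℕ := e.inducedStructureEquiv
  have hN' : L.ElementarilyEquivalent M (ULift.{w} ℕ) := hMN.trans (e'.toElementaryEmbedding.elementarilyEquivalent)
  obtain ⟨S, hS, hScard⟩ := exists_elementarySubstructure_card_eq L (range a) Cardinal.aleph0.{w}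
    le_rfl (by simp) (by
      rw [Cardinal.lift_aleph0, Cardinal.lift_le_aleph0]
      exact Cardinal.mk_le_aleph0_iff.2 (inferInstance : Countable L.Symbols)) (by simp)
  have hSM := S.elementarilyEquivalent
  have : S ⊨ L.completeTheory M := (ElementarilyEquivalent.theory_model_iff hSM.symm).1 inferInstance
  have : ULift.{w} ℕ ⊨ L.completeTheory M := (ElementarilyEquivalent.theory_model_iff hN').1 inferInstance
  obtain ⟨g⟩ := hcat (Theory.ModelType.of _ S) (Theory.ModelType.of _ (ULift.{w} ℕ))
    (by simpa using hScard) (by simp)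
  let h : S ≃[L] N := Language.Equiv.comp e'.symm g
  let a' : α → S := fun x => ⟨a x, hS ⟨x, rfl⟩⟩
  obtain ⟨ψ, hψ, hψ'⟩ := hN (h ∘ a')
  apply hψ'
  rw [StrongHomClass.realize_formula, ← S.subtype.map_formula]
  exact hψ

end ModelTheory

/-! ### Extending types and moving tuples off finite sets. -/

section Types

universe u v w

variable {L : FirstOrder.Language.{u, v}} {M : Type w} [L.Structure M] [Nonempty M]

theorem tp_eq_iff {α : Type} {a b : α → M} :
    tp L a = tp L b ↔ ∀ ψ : L.Formula α, ψ.Realize a ↔ ψ.Realize b := by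
  constructor
  · intro h ψ
    rw [← Theory.CompleteType.formula_mem_typeOf (T := L.completeTheory M),
      ← Theory.CompleteType.formula_mem_typeOf (T := L.completeTheory M)]
    exact iff_of_eq (congrArg (fun q => Formula.equivSentence ψ ∈ q) h)
  · intro h
    refine SetLike.ext fun σ => ?_
    rw [tp, tp, Theory.CompleteType.mem_typeOf, Theory.CompleteType.mem_typeOf]
    exact h _

theorem tp_comp {α β : Type} {a b : α → M} (h : tp L a = tp L b) (f : β → α) :
    tp L (a ∘ f) = tp L (b ∘ f) := by
  rw [tp_eq_iff] at h ⊢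
  intro ψ
  rw [← Formula.realize_relabel, ← Formula.realize_relabel]
  exact h _

theorem eq_iff_of_tp_eq {α : Type} {a b : α → M} (h : tp L a = tp L b) (x y : α) :
    a x = a y ↔ b x = b y := by
  have := tp_eq_iff.1 h (Term.equal (Term.var x) (Term.var y))
  simpa only [Formula.realize_equal, Term.realize_var] using this

theorem tp_eq_of_isIsolated {α : Type} {a : α → M} (h : IsIsolated L a) :
    ∃ φ : L.Formula α, φ.Realize a ∧ ∀ b : α → M, φ.Realize b → tp L b = tp L a := by
  obtain ⟨φ, hφ, h⟩ := h
  refine ⟨φ, hφ, fun b hb => tp_eq_iff.2 fun ψ => ⟨fun hψ => ?_, h b hb ψ⟩⟩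
  by_contra hn
  exact h b hb ψ.not hn hψ

theorem exists_tp_extension (hiso : ∀ (α : Type) [Finite α] (a : α → M), IsIsolated L a)
    {α β : Type} [Finite α] [Finite β] {a b : α → M} (h : tp L a = tp L b) (c : β → M) :
    ∃ d : β → M, tp L (Sum.elim a c) = tp L (Sum.elim b d) := by
  obtain ⟨φ, hφ, hiso⟩ := tp_eq_of_isIsolated (hiso _ (Sum.elim a c))
  obtain ⟨d, hd⟩ := Formula.realize_iExs.1 ((tp_eq_iff.1 h (φ.iExs β)).1
    (Formula.realize_iExs.2 ⟨c, hφ⟩))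
  exact ⟨d, (hiso _ hd).symm⟩

/-- If `x` is not in `a`, the formula isolating its type over `a` has infinitely many solutions,
since otherwise `x` would be algebraic over `a`. -/
theorem exists_fresh_element (hiso : ∀ (α : Type) [Finite α] (a : α → M), IsIsolated L a)
    (hacl : HasDegenerateAcl L M) {α : Type} [Finite α] (a : α → M) (x : M) {B : Set M}
    (hB : B.Finite) : ∃ y : M,
      tp L (Sum.elim a fun _ : Fin 1 => x) = tp L (Sum.elim a fun _ : Fin 1 => y) ∧
        (y ∈ range a ∨ y ∉ B) := by
  by_cases hx : x ∈ range a
  · exact ⟨x, rfl, Or.inl hx⟩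
  obtain ⟨φ, hφ, hφt⟩ := tp_eq_of_isIsolated (hiso _ (Sum.elim a fun _ : Fin 1 => x))
  let s : Set M := {y | φ.Realize (Sum.elim a fun _ : Fin 1 => y)}
  have hs : s.Infinite := by
    intro hfin
    refine hx (hacl (range a) ▸ (⟨s, ?_, hfin, hφ⟩ : x ∈ acl L (range a)))
    refine definable_iff_exists_formula_sum.2
      ⟨φ.relabel (Sum.map (fun i => ⟨a i, i, rfl⟩) id), ?_⟩
    ext z
    change φ.Realize _ ↔ Formula.Realize _ _
    rw [Formula.realize_relabel]
    refine iff_of_eq (congrArg _ ?_)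
    ext (i | i)
    · rfl
    · simp [Subsingleton.elim i 0]
  obtain ⟨y, hy, hyB⟩ := (hs.sdiff hB).nonempty
  exact ⟨y, (hφt _ hy).symm, Or.inr hyB⟩

/-- If algebraic closure is degenerate, a tuple `c` can be moved over `a` so that only its entries
in `a` remain in a given finite set. -/
theorem exists_fresh (hiso : ∀ (α : Type) [Finite α] (a : α → M), IsIsolated L a)
    (hacl : HasDegenerateAcl L M) {β : Type} [Finite β] {α : Type} [Finite α] (a : α → M)
    (c : β → M) {B : Set M} (hB : B.Finite) : ∃ d : β → M,
      tp L (Sum.elim a c) = tp L (Sum.elim a d) ∧ ∀ j, d j ∈ range a ∨ d j ∉ B := by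
  suffices H : ∀ (β : Type) [Finite β] (α : Type) [Finite α] (a : α → M) (c : β → M),
      ∃ d : β → M, tp L (Sum.elim a c) = tp L (Sum.elim a d) ∧ ∀ j, d j ∈ range a ∨ d j ∉ B from
    H β α a c
  intro β _
  induction β using Finite.induction_empty_option with
  | @of_equiv β γ e ih =>
    intro α _ a c
    obtain ⟨d, hd, hd'⟩ := ih α a (c ∘ e)
    refine ⟨d ∘ e.symm, ?_, fun j => hd' _⟩
    have := tp_comp hd (Sum.map id e.symm)
    convert this using 2 <;> ext (i | i) <;> simp
  | h_empty => exact fun α _ a c => ⟨c, rfl, fun j => j.elim⟩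
  | @h_option β _ ih =>
    intro α _ a c
    obtain ⟨y, hy, hyB⟩ := exists_fresh_element hiso hacl a (c none) hB
    obtain ⟨c', hc'⟩ := exists_tp_extension hiso hy (c ∘ some)
    -- The moved element `y` joins the base; a later entry equal to `y` is harmless because `y`
    -- already satisfies the conclusion.
    obtain ⟨d, hd, hdB⟩ := ih (α ⊕ Fin 1) (Sum.elim a fun _ => y) c'
    refine ⟨fun o => o.elim y d, ?_, ?_⟩
    · have := tp_comp (hc'.trans hd) (Sum.elim (fun i => Sum.inl (Sum.inl i))
        (fun o : Option β => o.elim (Sum.inl (Sum.inr 0)) Sum.inr))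
      convert this using 2 <;> ext (i | _ | i) <;> rfl
    · rintro (_ | j)
      · exact hyB
      · rcases hdB j with ⟨i | i, h⟩ | h
        · exact Or.inl ⟨i, h⟩
        · change y = d j at h
          exact h ▸ hyB
        · exact Or.inr h

end Types

/-! ### Type-invariant partial equivalence relations. -/

section Relations

universe u v w

variable {L : FirstOrder.Language.{u, v}} {M : Type w} [L.Structure M] [Nonempty M] {n : ℕ}

/-- A partial equivalence relation on `n`-tuples that is invariant under equality of types and whose
domain `{a | R a a}` consists of tuples of a single type. -/
structure IsInvariantPER (L : FirstOrder.Language.{u, v}) [L.Structure M]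
    (R : (Fin n → M) → (Fin n → M) → Prop) : Prop where
  symm : ∀ {a b}, R a b → R b a
  trans : ∀ {a b c}, R a b → R b c → R a c
  inv : ∀ {a b c d : Fin n → M}, tp L (Sum.elim a b) = tp L (Sum.elim c d) → R a b → R c d
  tp_eq : ∀ {a b : Fin n → M}, R a a → R b b → tp L a = tp L b

namespace IsInvariantPER

theorem left {R : (Fin n → M) → (Fin n → M) → Prop} (hR : IsInvariantPER L R) {a b : Fin n → M}
    (h : R a b) : R a a := hR.trans h (hR.symm h)

theorem right {R : (Fin n → M) → (Fin n → M) → Prop} (hR : IsInvariantPER L R) {a b : Fin n → M}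
    (h : R a b) : R b b := hR.trans (hR.symm h) h

theorem dom_of_tp_eq {R : (Fin n → M) → (Fin n → M) → Prop} (hR : IsInvariantPER L R)
    {a b : Fin n → M} (h : tp L a = tp L b) (ha : R a a) : R b b := by
  refine hR.inv ?_ ha
  have := tp_comp h (Sum.elim id id)
  convert this using 2 <;> ext (i | i) <;> rfl

end IsInvariantPER
end Relations

/-! ### Determining sets of coordinates and the permutation group. -/

section Determines

universe u v w

variable {L : FirstOrder.Language.{u, v}} {M : Type w} [L.Structure M] [Nonempty M] {n : ℕ}

theorem tp_right_eq {α β : Type} {a a' : α → M} {b b' : β → M}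
    (h : tp L (Sum.elim a b) = tp L (Sum.elim a' b')) : tp L b = tp L b' :=
  tp_comp h Sum.inr

theorem eq_iff_of_tp_elim_eq {α β : Type} {a a' : α → M} {b b' : β → M}
    (h : tp L (Sum.elim a b) = tp L (Sum.elim a' b')) (i : α) (j : β) :
    a i = b j ↔ a' i = b' j :=
  eq_iff_of_tp_eq h (Sum.inl i) (Sum.inr j)

theorem mem_range_iff_of_tp_elim_eq {α β : Type} {a a' : α → M} {b b' : β → M}
    (h : tp L (Sum.elim a b) = tp L (Sum.elim a' b')) (j : β) :
    b j ∈ range a ↔ b' j ∈ range a' :=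
  exists_congr fun i => eq_iff_of_tp_elim_eq h i j

/-- Tuples of the domain of `R` that agree on the coordinates in `J` are `R`-related. -/
def Determines (R : (Fin n → M) → (Fin n → M) → Prop) (J : Set (Fin n)) : Prop :=
  ∀ a b, R a a → R b b → (∀ j ∈ J, a j = b j) → R a b

/-- The amalgamation condition for tuples that agree on the coordinates in `J`. -/
theorem AmalgamationCondition.exists_of_agree {X : Set (Fin n → M)}
    (hX : AmalgamationCondition L X) {J : Set (Fin n)} (hJ : J ≠ univ) {a b c d : Fin n → M}
    (hmem : a ∈ X ∧ b ∈ X ∧ c ∈ X ∧ d ∈ X)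
    (hb : ∀ j ∈ J, b j = a j) (hc : ∀ j ∈ J, c j = a j) (hd : ∀ j ∈ J, d j = a j)
    (hab : ∀ i ∉ J, b i ∉ range a) (hac : ∀ i ∉ J, c i ∉ range a)
    (had : ∀ i ∉ J, d i ∉ range a) (hbc : ∀ i ∉ J, b i ∉ range c)
    (hbd : ∀ i ∉ J, d i ∉ range b) (hcd : ∀ i ∉ J, d i ∉ range c)
    (haJ : ∀ i ∉ J, ∀ j ∈ J, a i ≠ a j) :
    ∃ e : Fin n → M, tp L (Sum.elim e a) = tp L (Sum.elim c a) ∧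
      tp L (Sum.elim e b) = tp L (Sum.elim d b) := by
  classical
  let eJ := Fintype.equivFin J
  let eJ' := Fintype.equivFin (Jᶜ : Set (Fin n))
  let σ : Fin (Fintype.card J) ⊕ Fin (Fintype.card (Jᶜ : Set (Fin n))) ≃ Fin n :=
    (Equiv.sumCongr eJ.symm eJ'.symm).trans (Equiv.Set.sumCompl J)
  have hσl : ∀ x, σ (Sum.inl x) ∈ J := fun x => (eJ.symm x).2
  have hσr : ∀ x, σ (Sum.inr x) ∉ J := fun x => (eJ'.symm x).2
  let t (w : Fin n → M) := fun x => w (σ (Sum.inr x))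
  let a' := fun x => a (σ (Sum.inl x))
  have hcomb : ∀ w : Fin n → M, (∀ j ∈ J, w j = a j) → combine σ a' (t w) = w := by
    intro w hw
    ext i
    obtain ⟨x | x, rfl⟩ := σ.surjective i
    · simp only [combine, Equiv.symm_apply_apply, Sum.elim_inl, a', hw _ (hσl x)]
    · simp only [combine, Equiv.symm_apply_apply, Sum.elim_inr, t]
  have hdisj : ∀ w z : Fin n → M, (∀ i ∉ J, w i ∉ range z) →
      Disjoint (range (t z)) (range (t w)) := by
    intro w z h
    rw [Set.disjoint_left]
    rintro _ ⟨x, rfl⟩ ⟨y, hy⟩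
    exact h _ (hσr y) ⟨_, hy.symm⟩
  have hdisj' : ∀ w : Fin n → M, (∀ i ∉ J, w i ∉ range a) →
      Disjoint (range a') (range (t w)) := by
    intro w h
    rw [Set.disjoint_left]
    rintro _ ⟨x, rfl⟩ ⟨y, hy⟩
    exact h _ (hσr y) ⟨_, hy.symm⟩
  have hdisja : Disjoint (range a') (range (t a)) := by
    rw [Set.disjoint_left]
    rintro _ ⟨x, rfl⟩ ⟨y, hy⟩
    exact haJ _ (hσr y) _ (hσl x) hy
  have hcard : 0 < Fintype.card (Jᶜ : Set (Fin n)) := by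
    rw [Fintype.card_pos_iff, nonempty_coe_sort, nonempty_compl]
    exact hJ
  obtain ⟨e, he, he'⟩ := hX _ _ σ hcard a' (t a) (t b) (t c) (t d)
    (by simp [hdisj b a hab, hdisj c a hac, hdisj d a had, hdisj d b hbd, hdisj d c hcd,
      (hdisj b c hbc).symm])
    (by simp [hdisja, hdisj' b hab, hdisj' c hac, hdisj' d had])
    (by
      simp only [List.mem_cons, List.not_mem_nil, or_false, forall_eq_or_imp, forall_eq]
      rw [hcomb a fun _ _ => rfl, hcomb b hb, hcomb c hc, hcomb d hd]
      exact hmem)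
  -- Reindexing that recovers the type of two full tuples from the type of their free parts and the
  -- shared part.
  let f : Fin n ⊕ Fin n → Fin (Fintype.card (Jᶜ : Set (Fin n))) ⊕
      (Fin (Fintype.card (Jᶜ : Set (Fin n))) ⊕ Fin (Fintype.card J)) :=
    Sum.elim (fun i => (σ.symm i).elim (fun x => Sum.inr (Sum.inr x)) Sum.inl)
      (fun i => (σ.symm i).elim (fun x => Sum.inr (Sum.inr x)) fun x => Sum.inr (Sum.inl x))
  have hf : ∀ w z, Sum.elim w (Sum.elim z a') ∘ f =
      Sum.elim (combine σ a' w) (combine σ a' z) := by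
    intro w z
    ext (i | i) <;> obtain ⟨x | x, rfl⟩ := σ.surjective i <;> simp [f, combine]
  have h1 := tp_comp he f
  have h2 := tp_comp he' f
  rw [hf, hf, hcomb a fun _ _ => rfl] at h1
  rw [hf, hf, hcomb b hb] at h2
  rw [hcomb c hc] at h1
  rw [hcomb d hd] at h2
  exact ⟨_, h1, h2⟩

variable {R : (Fin n → M) → (Fin n → M) → Prop}

theorem exists_fresh_agreeing (hiso : ∀ (α : Type) [Finite α] (a : α → M), IsIsolated L a)
    (hacl : HasDegenerateAcl L M) (hR : IsInvariantPER L R) {a : Fin n → M} (ha : R a a)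
    (I : Set (Fin n)) {B : Set M} (hB : B.Finite) :
    ∃ b, R b b ∧ (∀ i ∈ I, b i = a i) ∧ ∀ j, b j ∈ a '' I ∨ b j ∉ B := by
  obtain ⟨b, hb, hbB⟩ := exists_fresh hiso hacl (fun i : I => a i) a hB
  refine ⟨b, hR.dom_of_tp_eq (tp_right_eq hb) ha, fun i hi => ?_, fun j => ?_⟩
  · exact ((eq_iff_of_tp_elim_eq hb ⟨i, hi⟩ i).1 rfl).symm
  · refine (hbB j).imp_left ?_
    rintro ⟨i, hi⟩
    exact ⟨i, i.2, hi⟩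

/-- Copy an inequivalent pair agreeing on `J` to `b`, `y'`, and take `g` agreeing with them on `J`
and disjoint from both elsewhere. As `b` and `y'` are inequivalent, `g` is inequivalent to one of
them; in the case of `y'`, transport the pair `y'`, `g` to start at `b`. -/
theorem exists_fresh_not_related (hiso : ∀ (α : Type) [Finite α] (a : α → M), IsIsolated L a)
    (hacl : HasDegenerateAcl L M) (hR : IsInvariantPER L R) {J : Set (Fin n)}
    (hJ : ¬ Determines R J) {b : Fin n → M} (hb : R b b) (hbJ : ∀ i ∉ J, ∀ j ∈ J, b i ≠ b j)
    {B : Set M} (hB : B.Finite) :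
    ∃ d, R d d ∧ ¬ R b d ∧ (∀ j ∈ J, d j = b j) ∧ ∀ i ∉ J, d i ∉ range b ∧ d i ∉ B := by
  suffices H : ∃ d, R d d ∧ ¬ R b d ∧ (∀ j ∈ J, d j = b j) ∧ ∀ i ∉ J, d i ∉ range b by
    obtain ⟨d, hd, hbd, hdJ, hdb⟩ := H
    obtain ⟨d', hd', hdB⟩ := exists_fresh hiso hacl b d hB
    refine ⟨d', hR.dom_of_tp_eq (tp_right_eq hd') hd, fun h => hbd (hR.inv hd'.symm h),
      fun j hj => ((eq_iff_of_tp_elim_eq hd' j j).1 (hdJ j hj).symm).symm, fun i hi => ?_⟩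
    have h1 := fun h => hdb i hi ((mem_range_iff_of_tp_elim_eq hd' i).2 h)
    exact ⟨h1, (hdB i).resolve_left h1⟩
  simp only [Determines, not_forall] at hJ
  obtain ⟨x, y, hx, hy, hxy, hnxy⟩ := hJ
  obtain ⟨y', hy'⟩ := exists_tp_extension hiso (hR.tp_eq hx hb) y
  have hy'R : R y' y' := hR.dom_of_tp_eq (tp_right_eq hy') hy
  have hy'b : ¬ R b y' := fun h => hnxy (hR.inv hy'.symm h)
  have hy'J : ∀ j ∈ J, y' j = b j := fun j hj =>
    ((eq_iff_of_tp_elim_eq hy' j j).1 (hxy j hj)).symm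
  obtain ⟨g, hg, hgJ, hgB⟩ := exists_fresh_agreeing hiso hacl hR hb J
    ((finite_range b).union (finite_range y'))
  have hgB' : ∀ i ∉ J, g i ∉ range b ∧ g i ∉ range y' := by
    intro i hi
    have : g i ∉ b '' J := by
      rintro ⟨j, hj, hji⟩
      rw [← hgJ j hj] at hji
      exact hbJ i hi j hj ((eq_iff_of_tp_eq (hR.tp_eq hg hb) i j).1 hji.symm)
    simpa only [mem_union, not_or] using (hgB i).resolve_left this
  by_cases hbg : R b g
  · obtain ⟨d, hd⟩ := exists_tp_extension hiso (hR.tp_eq hy'R hb) g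
    refine ⟨d, hR.dom_of_tp_eq (tp_right_eq hd) hg, fun h => ?_, fun j hj => ?_, fun i hi h => ?_⟩
    · exact hy'b (hR.trans hbg (hR.symm (hR.inv hd.symm h)))
    · exact ((eq_iff_of_tp_elim_eq hd j j).1 ((hy'J j hj).trans (hgJ j hj).symm)).symm
    · exact (hgB' i hi).2 ((mem_range_iff_of_tp_elim_eq hd i).2 h)
  · exact ⟨g, hg, hbg, hgJ, fun i hi => (hgB' i hi).1⟩

/-- If `R a b` holds for some tuples agreeing on `J` and otherwise disjoint, then agreement on `J`
implies `R`. -/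
theorem determines_of_agree (hiso : ∀ (α : Type) [Finite α] (a : α → M), IsIsolated L a)
    (hacl : HasDegenerateAcl L M) (hR : IsInvariantPER L R)
    (hstar : AmalgamationCondition L {a | R a a}) {J : Set (Fin n)} {a c : Fin n → M}
    (hac : R a c) (hJ : ∀ j ∈ J, c j = a j) (hc : ∀ i ∉ J, c i ∉ range a)
    (ha : ∀ i ∉ J, a i ∉ range c) : Determines R J := by
  by_contra hcon
  have hJne : J ≠ univ := by
    rintro rfl
    refine hcon fun x y hx _ hxy => ?_
    rwa [← funext fun j => hxy j (mem_univ j)]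
  have haJ : ∀ i ∉ J, ∀ j ∈ J, a i ≠ a j := fun i hi j hj h =>
    ha i hi ⟨j, (hJ j hj).trans h.symm⟩
  obtain ⟨b, hb, hbB⟩ := exists_fresh hiso hacl a c (finite_range c)
  have hab : R a b := hR.inv hb hac
  have hbJ : ∀ j ∈ J, b j = a j := fun j hj =>
    ((eq_iff_of_tp_elim_eq hb j j).1 (hJ j hj).symm).symm
  have hba : ∀ i ∉ J, b i ∉ range a := fun i hi h =>
    hc i hi ((mem_range_iff_of_tp_elim_eq hb i).2 h)
  have hbc : ∀ i ∉ J, b i ∉ range c := fun i hi => (hbB i).resolve_left (hba i hi)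
  obtain ⟨d, hd, hbd, hdJ, hdB⟩ := exists_fresh_not_related hiso hacl hR hcon (hR.right hab)
    (fun i hi j hj h => hba i hi ⟨j, ((hbJ j hj).symm.trans h.symm)⟩)
    ((finite_range a).union (finite_range c))
  simp only [mem_union, not_or] at hdB
  obtain ⟨e, he, he'⟩ := hstar.exists_of_agree hJne (a := a) (b := b) (c := c) (d := d)
    ⟨hR.left hac, hR.right hab, hR.right hac, hd⟩ hbJ hJ
    (fun j hj => (hdJ j hj).trans (hbJ j hj)) hba hc (fun i hi => (hdB i hi).2.1) hbc
    (fun i hi => (hdB i hi).1) (fun i hi => (hdB i hi).2.2) haJ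
  have h1 : R e a := hR.inv he.symm (hR.symm hac)
  exact hbd (hR.symm (hR.inv he' (hR.trans h1 hab)))

/-- A copy `c` of `b` over `a`, chosen fresh outside `a`, is equivalent to `b` and shares with it
exactly the entries lying in `a`; `determines_of_agree` then applies to `b` and `c`. -/
theorem determines_setOf_mem_range
    (hiso : ∀ (α : Type) [Finite α] (a : α → M), IsIsolated L a)
    (hacl : HasDegenerateAcl L M) (hR : IsInvariantPER L R)
    (hstar : AmalgamationCondition L {a | R a a}) {a b : Fin n → M} (hab : R a b) :
    Determines R {j | b j ∈ range a} := by
  obtain ⟨c, hc, hcB⟩ := exists_fresh hiso hacl a b (finite_range b)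
  have hcb : ∀ i, b i ∉ range a → c i ∉ range b := fun i hi =>
    (hcB i).resolve_left fun h => hi ((mem_range_iff_of_tp_elim_eq hc i).2 h)
  refine determines_of_agree hiso hacl hR hstar (a := b) (c := c)
    (hR.trans (hR.symm hab) (hR.inv hc hab)) ?_ hcb ?_
  · rintro j ⟨i, hi⟩
    exact ((eq_iff_of_tp_elim_eq hc i j).1 hi).symm.trans hi
  · rintro i hi ⟨j, hj⟩
    by_cases h : b j ∈ range a
    · obtain ⟨k, hk⟩ := h
      exact hi ⟨k, ((eq_iff_of_tp_elim_eq hc k j).1 hk).trans hj⟩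
    · exact hcb j h ⟨i, hj.symm⟩

/-- Refreshing all entries of `a` and `b` outside their `I`-parts preserves equivalence, and
afterwards any common entry comes from both `I`-parts. The positions of common entries form a
determining set, which can be cut down to `I`; minimality makes it contain `I`. -/
theorem mem_image_of_minimal_determines
    (hiso : ∀ (α : Type) [Finite α] (a : α → M), IsIsolated L a)
    (hacl : HasDegenerateAcl L M) (hR : IsInvariantPER L R)
    (hstar : AmalgamationCondition L {a | R a a}) {I : Set (Fin n)}
    (hI : Minimal (Determines R) I) {a b : Fin n → M} (hab : R a b) {i : Fin n} (hi : i ∈ I) :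
    b i ∈ a '' I := by
  obtain ⟨a', ha', haI, haB⟩ := exists_fresh_agreeing hiso hacl hR (hR.left hab) I (finite_range b)
  have ha'b : R a' b := hR.trans (hI.prop _ _ ha' (hR.left hab) haI) hab
  obtain ⟨b', hb', hbI, hbB⟩ := exists_fresh_agreeing hiso hacl hR (hR.right hab) I
    (finite_range a')
  have ha'b' : R a' b' := hR.trans ha'b (hR.symm (hI.prop _ _ hb' (hR.right hab) hbI))
  have hJ := determines_setOf_mem_range hiso hacl hR hstar ha'b'
  have key : ∀ j, b' j ∈ range a' → b' j ∈ b '' I ∧ b' j ∈ a '' I := by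
    intro j hj
    have h1 := (hbB j).resolve_right (not_not_intro hj)
    refine ⟨h1, ?_⟩
    obtain ⟨k, hk⟩ := hj
    rw [← hk]
    refine (haB k).resolve_right (not_not_intro ?_)
    rw [hk]
    exact image_subset_range _ _ h1
  -- Each common entry of `b'` also occurs at a coordinate in `I`, and this repetition holds in
  -- every tuple of the same type.
  have hIJ : Determines R (I ∩ {j | b' j ∈ range a'}) := by
    intro x y hx hy hxy
    refine hJ x y hx hy fun j hj => ?_
    obtain ⟨k, hk, hkj⟩ := (key j hj).1
    rw [← hbI k hk] at hkj
    rw [← (eq_iff_of_tp_eq (hR.tp_eq hb' hx) k j).1 hkj,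
      ← (eq_iff_of_tp_eq (hR.tp_eq hb' hy) k j).1 hkj]
    exact hxy k ⟨hk, (by rw [hkj]; exact hj : b' k ∈ range a')⟩
  have := (hI.le_of_le hIJ inter_subset_left hi).2
  rw [← hbI i hi]
  exact (key i this).2

/-- A coordinate repeating another one of `I` does so in all tuples of the domain, so it could be
dropped. -/
theorem injOn_of_minimal_determines (hR : IsInvariantPER L R) {I : Set (Fin n)}
    (hI : Minimal (Determines R) I) {a : Fin n → M} (ha : R a a) : InjOn a I := by
  intro i hi j hj hij
  by_contra hne
  have : Determines R (I \ {j}) := by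
    intro x y hx hy hxy
    refine hI.prop x y hx hy fun k hk => ?_
    by_cases hkj : k = j
    · subst hkj
      rw [← (eq_iff_of_tp_eq (hR.tp_eq ha hx) i k).1 hij,
        ← (eq_iff_of_tp_eq (hR.tp_eq ha hy) i k).1 hij]
      exact hxy i ⟨hi, hne⟩
    · exact hxy k ⟨hk, hkj⟩
  exact (hI.le_of_le this sdiff_subset hj).2 rfl

theorem exists_perm_of_minimal_determines
    (hiso : ∀ (α : Type) [Finite α] (a : α → M), IsIsolated L a)
    (hacl : HasDegenerateAcl L M) (hR : IsInvariantPER L R)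
    (hstar : AmalgamationCondition L {a | R a a}) {I : Set (Fin n)}
    (hI : Minimal (Determines R) I) {a b : Fin n → M} (hab : R a b) :
    ∃ γ : Equiv.Perm I, ∀ i : I, a i = b (γ i) := by
  have h : ∀ i : I, ∃ j : I, b j = a i := fun i => by
    obtain ⟨j, hj, hji⟩ := mem_image_of_minimal_determines hiso hacl hR hstar hI (hR.symm hab) i.2
    exact ⟨⟨j, hj⟩, hji⟩
  choose γ hγ using h
  have hinj : Function.Injective γ := fun i j hij => Subtype.ext <|
    injOn_of_minimal_determines hR hI (hR.left hab) i.2 j.2 (by rw [← hγ, ← hγ, hij])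
  exact ⟨Equiv.ofBijective γ (Finite.injective_iff_bijective.1 hinj), fun i => (hγ i).symm⟩

/-- Copy `b` over `c`: the copy and `d` have the same entries on `I`, both read off from `c` through
`γ`. -/
theorem Determines.related_of_perm
    (hiso : ∀ (α : Type) [Finite α] (a : α → M), IsIsolated L a)
    (hR : IsInvariantPER L R) {I : Set (Fin n)} (hI : Determines R I) {a b c d : Fin n → M}
    (hab : R a b) {γ : Equiv.Perm I} (hγ : ∀ i : I, a i = b (γ i)) (hc : R c c) (hd : R d d)
    (hcd : ∀ i : I, c i = d (γ i)) : R c d := by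
  obtain ⟨b', hb'⟩ := exists_tp_extension hiso (hR.tp_eq (hR.left hab) hc) b
  have hcb' : R c b' := hR.inv hb' hab
  refine hR.trans hcb' (hI _ _ (hR.right hcb') hd fun j hj => ?_)
  obtain ⟨i, hi⟩ := γ.surjective ⟨j, hj⟩
  have h1 := (eq_iff_of_tp_elim_eq hb' i (γ i)).1 (hγ i)
  rw [hcd i, hi] at h1
  exact h1.symm

/-- The permutations of the coordinates in `I` that carry a tuple to an `R`-related one. -/
def permGroup (hiso : ∀ (α : Type) [Finite α] (a : α → M), IsIsolated L a)
    (hR : IsInvariantPER L R) (hne : ∃ a, R a a) (I : Set (Fin n)) :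
    Subgroup (Equiv.Perm I) where
  carrier := {γ | ∃ a b, R a b ∧ ∀ i : I, a i = b (γ i)}
  one_mem' := hne.imp fun a ha => ⟨a, ha, fun _ => rfl⟩
  inv_mem' := by
    rintro γ ⟨a, b, hab, h⟩
    exact ⟨b, a, hR.symm hab, fun i => by simp [h]⟩
  mul_mem' := by
    rintro γ δ ⟨c, d, hcd, h⟩ ⟨a, b, hab, h'⟩
    -- The pair `c`, `d` is moved to start at `b`, so that the two permutations compose along `a`,
    -- `b`, `d'`.
    obtain ⟨d', hd'⟩ := exists_tp_extension hiso (hR.tp_eq (hR.left hcd) (hR.right hab)) d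
    refine ⟨a, d', hR.trans hab (hR.inv hd' hcd), fun i => (h' i).trans ?_⟩
    exact (eq_iff_of_tp_elim_eq hd' _ _).1 (h (δ i))

end Determines

end DegenerateAcl

/-! ### The main theorem. -/

theorem theorem6p1 {L : FirstOrder.Language} [Countable L.Symbols]
    {M : Type*} [L.Structure M] [Nonempty M]
    (hcat : DegenerateAcl.IsOmegaCategorical L M)
    (hacl : DegenerateAcl.HasDegenerateAcl L M)
    {n : ℕ} (hn : 0 < n)
    (p : (L.completeTheory M).CompleteType (Fin n))
    (hstar : DegenerateAcl.AmalgamationCondition L (DegenerateAcl.realizations p))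
    (E : Setoid (DegenerateAcl.realizations p))
    (hdef : DegenerateAcl.IsDefinableOn L E)
    (hE : DegenerateAcl.IsNontrivialEquiv E) :
    ∃ I : Finset (Fin n), I.Nonempty ∧ ∃ Γ : Subgroup (Equiv.Perm I),
      ∀ a b : DegenerateAcl.realizations p,
        E a b ↔ ∃ γ ∈ Γ, ∀ i : I, a.1 i = b.1 (γ i) := by
  classical
  open DegenerateAcl in
  have := infinite_of_hasDegenerateAcl hacl
  have hiso : ∀ (α : Type) [Finite α] (a : α → M), IsIsolated L a := fun α _ a => hcat.isIsolated a
  -- `E` is extended by falsity to all tuples; definability of `E` makes the result invariant under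
  -- equality of types.
  let R (a b : Fin n → M) : Prop :=
    ∃ (ha : a ∈ realizations p) (hb : b ∈ realizations p), E ⟨a, ha⟩ ⟨b, hb⟩
  have hdom : ∀ a, R a a ↔ a ∈ realizations p := fun a =>
    ⟨fun h => h.1, fun h => ⟨h, h, E.refl _⟩⟩
  have hER : ∀ a b : realizations p, E a b ↔ R a.1 b.1 := fun a b =>
    ⟨fun h => ⟨a.2, b.2, h⟩, fun ⟨_, _, h⟩ => h⟩
  have hR : IsInvariantPER L R := by
    obtain ⟨φ, hφ⟩ := hdef
    refine ⟨fun ⟨ha, hb, h⟩ => ⟨hb, ha, E.symm h⟩,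
      fun ⟨ha, _, h⟩ ⟨_, hc, h'⟩ => ⟨ha, hc, E.trans h h'⟩, ?_,
      fun ha hb => ha.1.trans hb.1.symm⟩
    rintro a b c d h ⟨ha, hb, hab⟩
    have hc : c ∈ realizations p := (tp_comp h Sum.inl).symm.trans ha
    have hd : d ∈ realizations p := (tp_comp h Sum.inr).symm.trans hb
    exact ⟨hc, hd, (hφ _ _).2 ((tp_eq_iff.1 h φ).1 ((hφ _ _).1 hab))⟩
  have hstar' : AmalgamationCondition L {a | R a a} := by
    rwa [show {a | R a a} = realizations p from Set.ext hdom]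
  obtain ⟨I₀, -, hI₀⟩ := exists_minimal_le_of_wellFoundedLT (Determines R) Set.univ
    (fun a b ha _ hab => by rwa [← funext fun j => hab j (Set.mem_univ j)])
  obtain ⟨I, rfl⟩ : ∃ I : Finset (Fin n), I₀ = ↑I := ⟨I₀.toFinset, by simp⟩
  obtain ⟨⟨x, y, hxy⟩, -⟩ := hE
  have hx := (hdom x.1).2 x.2
  rw [hER] at hxy
  refine ⟨I, Finset.nonempty_iff_ne_empty.2 ?_,
    permGroup hiso hR ⟨x.1, hx⟩ (I : Set (Fin n)), fun a b => ?_⟩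
  -- If the empty set were determining, all of the tuples would be equivalent.
  · rintro rfl
    exact hxy (hI₀.prop _ _ hx ((hdom y.1).2 y.2) (by simp))
  rw [hER]
  constructor
  · intro hab
    obtain ⟨γ, hγ⟩ := exists_perm_of_minimal_determines hiso hacl hR hstar' hI₀ hab
    exact ⟨γ, ⟨_, _, hab, hγ⟩, hγ⟩
  · rintro ⟨γ, ⟨c, d, hcd, hγ⟩, h⟩
    exact hI₀.prop.related_of_perm hiso hR hcd hγ ((hdom a.1).2 a.2) ((hdom b.1).2 b.2) h
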